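/- For a prime power $q$ and an integer $m\ge 1$, let $Sp(2m,q)$ be the symplectic graph: its vertices are the one-dimensional subspaces of $\mathbb{F}_q^{2m}$, and two of them are adjacent if and only if they are not orthogonal with respect to the standard nondegenerate symplectic form on $\mathbb{F}_q^{2m}$. The energy $\|G\|_*$ of a finite graph $G$ is the sum of the absolute values of the eigenvalues (with multiplicity) of its adjacency matrix. Let $q$ be a prime power. (a) For every $n_0$ there exist integers $n>n_0$ and $k$ and a $k$-regular graph $G$ of order $n$, isomorphic to $Sp(2m,q)$ for some $m\ge 1$, such that $$k=\frac{q-1}{q}\,n+\frac1q\qquad\text{and}\qquad \|G\|_*=k+\sqrt{k(n-k)(n-1)}.$$ (b) For every $n_0$ there exist integers $n>n_0$ and $k$ and a $k$-regular graph $G$ of order $n$, isomorphic to the complement of $Sp(2m,q)$ for some $m\ge 1$, such that $$k=\frac{n}{q}-\frac{q+1}{q}\qquad\text{and}\qquad \|G\|_*>\sqrt{k(n-k)n}-n+k+1.$$ -/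

import Mathlib

/-- The symplectic form `v J wᵗ` on `F ^ (2m)`, where `J` is the standard block matrix
`[[0, -1], [1, 0]]`. -/
def sympForm {F : Type*} [Field F] {m : ℕ} (v w : Fin m ⊕ Fin m → F) : F :=
  v ⬝ᵥ (Matrix.J (Fin m) F).mulVec w

theorem sympForm_eq {F : Type*} [Field F] {m : ℕ} (v w : Fin m ⊕ Fin m → F) :
    sympForm v w = ∑ i, (v (Sum.inr i) * w (Sum.inl i) - v (Sum.inl i) * w (Sum.inr i)) := by
  simp [sympForm, Matrix.J, Matrix.mulVec, dotProduct, Fintype.sum_sum_type, Matrix.one_apply,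
    Finset.sum_sub_distrib]
  ring

theorem sympForm_self {F : Type*} [Field F] {m : ℕ} (v : Fin m ⊕ Fin m → F) :
    sympForm v v = 0 := by
  rw [sympForm_eq]
  exact Finset.sum_eq_zero fun i _ => by ring

theorem sympForm_swap {F : Type*} [Field F] {m : ℕ} (v w : Fin m ⊕ Fin m → F) :
    sympForm v w = - sympForm w v := by
  rw [sympForm_eq, sympForm_eq, ← Finset.sum_neg_distrib]
  exact Finset.sum_congr rfl fun i _ => by ring

/-- The symplectic graph `Sp(2m, F)`: its vertices are the one-dimensional subspaces of
`F ^ (2m)`, two of them being adjacent when they are not orthogonal with respect to the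
symplectic form. -/
def symplecticGraph (F : Type*) [Field F] (m : ℕ) :
    SimpleGraph (Projectivization F (Fin m ⊕ Fin m → F)) where
  Adj x y := sympForm x.rep y.rep ≠ 0
  symm := ⟨fun x y h => by rw [sympForm_swap]; exact neg_ne_zero.mpr h⟩
  loopless := ⟨fun x h => h (sympForm_self x.rep)⟩

/-- Adjacency in the symplectic graph does not depend on the chosen representatives. -/
theorem symplecticGraph_adj_mk {F : Type*} [Field F] {m : ℕ} (v w : Fin m ⊕ Fin m → F)
    (hv : v ≠ 0) (hw : w ≠ 0) :
    (symplecticGraph F m).Adj (Projectivization.mk F v hv) (Projectivization.mk F w hw) ↔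
      sympForm v w ≠ 0 := by
  obtain ⟨a, ha⟩ := Projectivization.exists_smul_eq_mk_rep F v hv
  obtain ⟨b, hb⟩ := Projectivization.exists_smul_eq_mk_rep F w hw
  have h : sympForm (a • v) (b • w) = (a : F) * (b : F) * sympForm v w := by
    rw [sympForm_eq, sympForm_eq, Finset.mul_sum]
    refine Finset.sum_congr rfl fun i _ => ?_
    simp only [Pi.smul_apply, Units.smul_def, smul_eq_mul]
    ring
  change sympForm _ _ ≠ 0 ↔ _
  rw [← ha, ← hb, h]
  simp

/-- The energy of a finite graph: the sum of the absolute values of the eigenvalues, counted with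
multiplicity, of its (real symmetric) adjacency matrix. -/
noncomputable def graphEnergy {V : Type*} [Fintype V] [DecidableEq V] (G : SimpleGraph V)
    [DecidableRel G.Adj] : ℝ :=
  ∑ i, |(G.isHermitian_adjMatrix ℝ).eigenvalues i|

/-!
Solving linear systems over `F` shows that any two distinct points of `Sp(2m, q)`, adjacent or
not, have the same number `μ` of common neighbours. So its adjacency matrix `A` satisfies
`(A - s) (A + s) = μ J` with `J` the all-ones matrix and `s = q ^ (m - 1)`. An identity
`(A - θ) (A - τ) = c J` of a regular graph passes to the complement, with `-1 - τ` and `-1 - θ`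
in place of `θ` and `τ`, and it leaves only the degree, `θ` and `τ` as possible eigenvalues.
On these three values `|x|` agrees with a quadratic polynomial, so the energy is determined by
the traces of `A` and `(A - θ) (A - τ)`.
-/

open Finset Polynomial
open scoped Matrix LinearAlgebra.Projectivization

section Hermitian

variable {𝕜 n : Type*} [RCLike 𝕜] [Fintype n] [DecidableEq n] {A : Matrix n n 𝕜}

theorem sum_eval_eigenvalues_eq_trace_aeval (hA : A.IsHermitian) (p : ℝ[X]) :
    ((∑ i, p.eval (hA.eigenvalues i) : ℝ) : 𝕜) = (aeval A p).trace := by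
  rw [← cfc_polynomial p A hA.isSelfAdjoint, hA.cfc_eq, Matrix.IsHermitian.cfc,
    Unitary.conjStarAlgAut_apply, Matrix.trace_mul_comm, ← mul_assoc]
  simp [Matrix.trace_diagonal]

theorem eval_eigenvalues_eq_zero_of_aeval_eq_zero (hA : A.IsHermitian) {p : ℝ[X]}
    (hp : aeval A p = 0) (i : n) : p.eval (hA.eigenvalues i) = 0 := by
  have : Nonempty n := ⟨i⟩
  have hmem := spectrum.subset_polynomial_aeval A p ⟨_, hA.eigenvalues_mem_spectrum_real i, rfl⟩
  rwa [hp, spectrum.zero_eq, Set.mem_singleton_iff] at hmem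

end Hermitian

section AllOnes

variable {V R : Type*} [Fintype V] [NonAssocSemiring R] {G : SimpleGraph V} [DecidableRel G.Adj]
  {d : ℕ}

theorem of_one_mul_of_one :
    (Matrix.of 1 * Matrix.of 1 : Matrix V V R) = (Fintype.card V : R) • Matrix.of 1 := by
  ext v w
  simp [Matrix.mul_apply]

theorem adjMatrix_mul_of_one (hG : G.IsRegularOfDegree d) :
    G.adjMatrix R * Matrix.of 1 = (d : R) • Matrix.of 1 := by
  ext v w
  simp [hG.degree_eq]

theorem of_one_mul_adjMatrix (hG : G.IsRegularOfDegree d) :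
    Matrix.of 1 * G.adjMatrix R = (d : R) • Matrix.of 1 := by
  ext v w
  simp [hG.degree_eq]

end AllOnes

theorem adjMatrix_compl_eq {V R : Type*} [DecidableEq V] [Ring R] (G : SimpleGraph V)
    [DecidableRel G.Adj] : Gᶜ.adjMatrix R = Matrix.of 1 - 1 - G.adjMatrix R := by
  classical
  rw [← G.one_add_adjMatrix_add_compl_adjMatrix_eq_of_one (α := R),
    G.compl_adjMatrix_eq_adjMatrix_compl R]
  abel

theorem exists_quadratic_interpolation {K : Type*} [Field K] {θ τ : K} (hne : θ ≠ τ) (f : K → K)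
    (d : K) :
    ∃ a b c, ∀ x, x = d ∨ x = θ ∨ x = τ → f x = a + b * x + c * ((x - θ) * (x - τ)) := by
  have hne' : θ - τ ≠ 0 := sub_ne_zero.2 hne
  obtain ⟨b, hb⟩ : ∃ b, b * (θ - τ) = f θ - f τ := ⟨_, div_mul_cancel₀ _ hne'⟩
  obtain ⟨a, ha⟩ : ∃ a, a = f θ - b * θ := ⟨_, rfl⟩
  have hθ : f θ = a + b * θ := by linear_combination -ha
  have hτ : f τ = a + b * τ := by linear_combination hb - ha
  obtain ⟨c, hc⟩ : ∃ c, f d = a + b * d + c * ((d - θ) * (d - τ)) := by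
    by_cases hd : (d - θ) * (d - τ) = 0
    · rcases mul_eq_zero.1 hd with hd | hd
      · exact ⟨0, by rw [sub_eq_zero.1 hd, hθ]; ring⟩
      · exact ⟨0, by rw [sub_eq_zero.1 hd, hτ]; ring⟩
    · exact ⟨(f d - a - b * d) / ((d - θ) * (d - τ)), by rw [div_mul_cancel₀ _ hd]; ring⟩
  refine ⟨a, b, c, ?_⟩
  rintro x (rfl | rfl | rfl)
  · exact hc
  · rw [hθ]; ring
  · rw [hτ]; ring

section Real

theorem sqrt_mul_mul_lt {q s d : ℝ} (hq : 2 ≤ q) (hs : 1 ≤ s) (hd : s ^ 2 ≤ d + 1) :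
    √(d * (q * s ^ 2 + 1) * (q * (d + 1) + 1)) < q * (d + 1) + q * s * d := by
  have hd0 : 0 ≤ d := by nlinarith
  have hgap : 0 ≤ 2 * q ^ 2 * (s * (d + 1)) - (q ^ 2 + q) * s ^ 2 - q * (d + 1) := by
    have hs1 : s ^ 2 ≤ s * (d + 1) := by nlinarith
    have hs2 : d + 1 ≤ s * (d + 1) := by nlinarith
    have hs3 : (q ^ 2 + q) * s ^ 2 ≤ (q ^ 2 + q) * (s * (d + 1)) := by gcongr
    have hs4 : q * (d + 1) ≤ q * (s * (d + 1)) := by gcongr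
    have hs5 : 0 ≤ (q * (q - 2)) * (s * (d + 1)) :=
      mul_nonneg (mul_nonneg (by linarith) (by linarith)) (by positivity)
    linarith
  have hsq : d < (q * (d + 1)) ^ 2 :=
    calc d < q * (d + 1) := by nlinarith
      _ ≤ (q * (d + 1)) ^ 2 := le_self_pow₀ (by nlinarith) two_ne_zero
  rw [Real.sqrt_lt' (by positivity)]
  linear_combination d * hgap + hsq

theorem sqrt_mul_mul_lt_sub_div {n k s : ℝ} (hs : 1 ≤ s) (hks : 2 * s ^ 2 ≤ k)
    (hn : k * (n - k) = s ^ 2 * (n - 1)) :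
    √((n - 1 - k) * (k + 1) * n) < (n - 1) * (s + 1) - k / s := by
  have hs0 : 0 < s := by linarith
  -- The quotient `k / s ^ 2` is the field size of a symplectic graph, and `d` is the degree of
  -- the complement.
  obtain ⟨q, rfl⟩ : ∃ q, k = q * s ^ 2 := ⟨k / s ^ 2, by field_simp⟩
  obtain ⟨d, rfl⟩ : ∃ d, n = d + 1 + q * s ^ 2 := ⟨n - 1 - q * s ^ 2, by ring⟩
  have hq : 2 ≤ q := le_of_mul_le_mul_right hks (by positivity)
  have hn' : q * (d + 1) = d + q * s ^ 2 :=
    mul_right_cancel₀ (pow_ne_zero 2 hs0.ne') (by linear_combination hn)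
  have hd : s ^ 2 ≤ d + 1 := by
    refine le_of_mul_le_mul_left ?_ (by linarith : 0 < q - 1)
    linarith [one_le_pow₀ hs (n := 2)]
  convert sqrt_mul_mul_lt hq hs hd using 1
  · congr 1
    linear_combination (-d * (q * s ^ 2 + 1)) * hn'
  · field_simp
    linear_combination (-(s + 1)) * hn'

end Real

section RestrictedEigenvalues

variable {V : Type*} [Fintype V] [DecidableEq V] {G : SimpleGraph V} [DecidableRel G.Adj]

/-- The matrix form of the statement that `G` has at most the two restricted eigenvalues `θ` and
`τ` (those with an eigenvector orthogonal to the all-ones vector): `(A - θ) (A - τ)` is a multiple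
of the all-ones matrix. The multiple is left unspecified so that the notion is stable under
complements. -/
def HasRestrictedEigenvalues (G : SimpleGraph V) [DecidableRel G.Adj] (θ τ : ℝ) : Prop :=
  ∃ c : ℝ, (G.adjMatrix ℝ - θ • 1) * (G.adjMatrix ℝ - τ • 1) = c • Matrix.of 1

namespace HasRestrictedEigenvalues

variable {θ τ : ℝ} {d : ℕ}

theorem of_isSRGWith {n k l μ : ℕ} (h : G.IsSRGWith n k l μ) (hadd : θ + τ = l - μ)
    (hmul : θ * τ = μ - k) : HasRestrictedEigenvalues G θ τ := by
  refine ⟨μ, ?_⟩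
  have hsq := h.matrix_eq (α := ℝ)
  simp only [adjMatrix_compl_eq, ← Nat.cast_smul_eq_nsmul ℝ] at hsq
  set A := G.adjMatrix ℝ
  calc (A - θ • 1) * (A - τ • 1) = A ^ 2 - (θ + τ) • A + (θ * τ) • 1 := by
        simp only [sub_mul, mul_sub, smul_mul_assoc, mul_smul_comm, one_mul, mul_one, sq]
        module
    _ = (μ : ℝ) • Matrix.of 1 := by
        rw [hsq, hadd, hmul]
        module

theorem compl (h : HasRestrictedEigenvalues G θ τ) (hG : G.IsRegularOfDegree d) :
    HasRestrictedEigenvalues Gᶜ (-1 - τ) (-1 - θ) := by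
  obtain ⟨c, hc⟩ := h
  set A := G.adjMatrix ℝ
  set J : Matrix V V ℝ := Matrix.of 1
  refine ⟨Fintype.card V - (d - θ) - (d - τ) + c, ?_⟩
  calc (Gᶜ.adjMatrix ℝ - (-1 - τ) • 1) * (Gᶜ.adjMatrix ℝ - (-1 - θ) • 1)
      = (J - (A - τ • 1)) * (J - (A - θ • 1)) := by
        rw [adjMatrix_compl_eq]
        congr 1 <;> module
    _ = J * J - (J * A - θ • J) - (A * J - τ • J) + (A - θ • 1) * (A - τ • 1) := by
        simp only [sub_mul, mul_sub, smul_mul_assoc, mul_smul_comm, one_mul, mul_one]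
        module
    _ = (Fintype.card V - (d - θ) - (d - τ) + c) • J := by
        rw [of_one_mul_of_one, of_one_mul_adjMatrix hG, adjMatrix_mul_of_one hG, hc]
        module

theorem eigenvalues_eq_or (h : HasRestrictedEigenvalues G θ τ) (hG : G.IsRegularOfDegree d)
    (i : V) :
    (G.isHermitian_adjMatrix ℝ).eigenvalues i = d ∨
      (G.isHermitian_adjMatrix ℝ).eigenvalues i = θ ∨
      (G.isHermitian_adjMatrix ℝ).eigenvalues i = τ := by
  obtain ⟨c, hc⟩ := h
  have hzero : aeval (G.adjMatrix ℝ) ((X - C (d : ℝ)) * ((X - C θ) * (X - C τ))) = 0 := by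
    simp only [map_mul, map_sub, aeval_X, aeval_C, Algebra.algebraMap_eq_smul_one, hc]
    rw [mul_smul_comm, sub_mul, adjMatrix_mul_of_one hG, smul_mul_assoc, one_mul, sub_self,
      smul_zero]
  simpa [sub_eq_zero] using
    eval_eigenvalues_eq_zero_of_aeval_eq_zero (G.isHermitian_adjMatrix ℝ) hzero i

theorem sub_mul_sub_eq [Nonempty V] (h : HasRestrictedEigenvalues G θ τ)
    (hG : G.IsRegularOfDegree d) :
    (G.adjMatrix ℝ - θ • 1) * (G.adjMatrix ℝ - τ • 1) = (d + θ * τ) • Matrix.of 1 := by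
  obtain ⟨c, hc⟩ := h
  obtain ⟨v⟩ := ‹Nonempty V›
  have hdiag : d + θ * τ = c := by
    simpa [sub_mul, mul_sub, mul_comm τ, -SimpleGraph.adjMatrix_mul_apply,
      -SimpleGraph.mul_adjMatrix_apply, SimpleGraph.adjMatrix_mul_self_apply_self,
      hG.degree_eq] using congrFun₂ hc v v
  rw [hc, hdiag]

theorem card_mul_degree_add_mul [Nonempty V] (h : HasRestrictedEigenvalues G θ τ)
    (hG : G.IsRegularOfDegree d) :
    Fintype.card V * (d + θ * τ) = (d - θ) * (d - τ) := by
  obtain ⟨v⟩ := ‹Nonempty V›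
  have hJ : ((d - θ) * (d - τ)) • (Matrix.of 1 : Matrix V V ℝ) =
      (Fintype.card V * (d + θ * τ)) • Matrix.of 1 :=
    calc ((d - θ) * (d - τ)) • (Matrix.of 1 : Matrix V V ℝ)
        = (G.adjMatrix ℝ - θ • 1) * ((G.adjMatrix ℝ - τ • 1) * Matrix.of 1) := by
          simp only [sub_mul, mul_sub, smul_mul_assoc, mul_smul_comm, one_mul,
            adjMatrix_mul_of_one hG]
          module
      _ = (Fintype.card V * (d + θ * τ)) • Matrix.of 1 := by
          rw [← mul_assoc, h.sub_mul_sub_eq hG, smul_mul_assoc, of_one_mul_of_one]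
          module
  simpa using (congrFun₂ hJ v v).symm

theorem sum_eigenvalues_sub_mul_sub [Nonempty V] (h : HasRestrictedEigenvalues G θ τ)
    (hG : G.IsRegularOfDegree d) :
    ∑ i, ((G.isHermitian_adjMatrix ℝ).eigenvalues i - θ) *
      ((G.isHermitian_adjMatrix ℝ).eigenvalues i - τ) = (d - θ) * (d - τ) := by
  have htrace := sum_eval_eigenvalues_eq_trace_aeval (G.isHermitian_adjMatrix ℝ)
    ((X - C θ) * (X - C τ))
  simp only [map_mul, map_sub, aeval_X, aeval_C, Algebra.algebraMap_eq_smul_one,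
    h.sub_mul_sub_eq hG] at htrace
  rw [← h.card_mul_degree_add_mul hG]
  simpa [Matrix.trace, mul_add] using htrace

theorem sum_apply_eigenvalues [Nonempty V] (h : HasRestrictedEigenvalues G θ τ)
    (hG : G.IsRegularOfDegree d) (hne : θ ≠ τ) (f : ℝ → ℝ) :
    ∑ i, f ((G.isHermitian_adjMatrix ℝ).eigenvalues i) =
      f d + ((-τ * (Fintype.card V - 1) - d) * f θ + (d + θ * (Fintype.card V - 1)) * f τ) /
        (θ - τ) := by
  set hA := G.isHermitian_adjMatrix ℝ
  have hne' : θ - τ ≠ 0 := sub_ne_zero.2 hne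
  obtain ⟨a, b, c, hf⟩ := exists_quadratic_interpolation hne f d
  have hsum : ∑ i, hA.eigenvalues i = 0 := by simpa using hA.trace_eq_sum_eigenvalues.symm
  rw [sum_congr rfl fun i _ => hf _ (h.eigenvalues_eq_or hG i), sum_add_distrib, sum_add_distrib,
    ← mul_sum, ← mul_sum, hsum, h.sum_eigenvalues_sub_mul_sub hG, sum_const, card_univ,
    nsmul_eq_mul, hf d (.inl rfl), hf θ (.inr (.inl rfl)), hf τ (.inr (.inr rfl))]
  field_simp
  ring

theorem graphEnergy_eq [Nonempty V] (h : HasRestrictedEigenvalues G θ τ)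
    (hG : G.IsRegularOfDegree d) (hθ : 0 ≤ θ) (hτ : τ < 0) :
    graphEnergy G = d - (2 * θ * τ * (Fintype.card V - 1) + d * (θ + τ)) / (θ - τ) := by
  rw [graphEnergy, h.sum_apply_eigenvalues hG (hτ.trans_le hθ).ne' (|·|), Nat.abs_cast,
    abs_of_nonneg hθ, abs_of_neg hτ]
  ring

variable [Nonempty V] {k : ℕ} {s : ℝ}

theorem degree_mul_card_sub_degree (h : HasRestrictedEigenvalues G s (-s))
    (hG : G.IsRegularOfDegree k) :
    k * (Fintype.card V - k : ℝ) = s ^ 2 * (Fintype.card V - 1) := by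
  linear_combination h.card_mul_degree_add_mul hG

theorem graphEnergy_eq_add_sqrt (h : HasRestrictedEigenvalues G s (-s))
    (hG : G.IsRegularOfDegree k) (hs : 0 < s) :
    graphEnergy G = k + √((k : ℝ) * (Fintype.card V - k) * (Fintype.card V - 1)) := by
  have hcard : (1 : ℝ) ≤ Fintype.card V := Nat.one_le_cast.2 Fintype.card_pos
  have hsq : s ^ 2 * (Fintype.card V - 1) * (Fintype.card V - 1) =
      (s * (Fintype.card V - 1)) ^ 2 := by ring
  rw [h.graphEnergy_eq hG hs.le (neg_lt_zero.2 hs), h.degree_mul_card_sub_degree hG, hsq,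
    Real.sqrt_sq (mul_nonneg hs.le (sub_nonneg.2 hcard))]
  field_simp
  ring

theorem sqrt_sub_lt_graphEnergy_compl (h : HasRestrictedEigenvalues G s (-s))
    (hG : G.IsRegularOfDegree k) (hs : 1 ≤ s) (hks : 2 * s ^ 2 ≤ k) :
    √((Fintype.card V - 1 - k) * (k + 1) * Fintype.card V : ℝ) - k < graphEnergy Gᶜ := by
  have hs0 : s ≠ 0 := (zero_lt_one.trans_le hs).ne'
  have hlt : k < Fintype.card V := by
    obtain ⟨v⟩ := ‹Nonempty V›
    exact hG.degree_eq v ▸ G.degree_lt_card_verts v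
  have hcast : ((Fintype.card V - 1 - k : ℕ) : ℝ) = Fintype.card V - 1 - k := by
    rw [Nat.cast_sub (by lia), Nat.cast_sub (by lia), Nat.cast_one]
  have hcompl : HasRestrictedEigenvalues Gᶜ (s - 1) (-1 - s) := by
    convert h.compl hG using 1
    ring
  rw [hcompl.graphEnergy_eq hG.compl (by linarith) (by linarith), hcast]
  refine (sub_lt_sub_right
    (sqrt_mul_mul_lt_sub_div hs hks (h.degree_mul_card_sub_degree hG)) _).trans_eq ?_
  have hgap : s - 1 - (-1 - s) = 2 * s := by ring
  rw [hgap]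
  field_simp
  ring

end HasRestrictedEigenvalues

end RestrictedEigenvalues

section Isomorphism

variable {V W : Type*} [Fintype V] [DecidableEq V] [Fintype W] [DecidableEq W]
  {G : SimpleGraph V} [DecidableRel G.Adj] {H : SimpleGraph W} [DecidableRel H.Adj]

theorem graphEnergy_eq_sum_roots_charpoly (G : SimpleGraph V) [DecidableRel G.Adj] :
    graphEnergy G = ((G.adjMatrix ℝ).charpoly.roots.map (|·|)).sum := by
  rw [(G.isHermitian_adjMatrix ℝ).roots_charpoly_eq_eigenvalues, Multiset.map_map]
  rfl

theorem graphEnergy_congr (e : G ≃g H) : graphEnergy G = graphEnergy H := by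
  rw [graphEnergy_eq_sum_roots_charpoly, graphEnergy_eq_sum_roots_charpoly,
    ← e.reindex_adjMatrix ℝ, Matrix.charpoly_reindex]

theorem exists_iso_fin_of_isRegularOfDegree {k : ℕ} (hH : H.IsRegularOfDegree k) :
    ∃ (G : SimpleGraph (Fin (Fintype.card W))) (_ : DecidableRel G.Adj),
      Nonempty (G ≃g H) ∧ G.IsRegularOfDegree k ∧ graphEnergy G = graphEnergy H := by
  let e : H.comap (Fintype.equivFin W).symm ≃g H := SimpleGraph.Iso.comap _ H
  refine ⟨_, inferInstance, ⟨e⟩, fun v => ?_, graphEnergy_congr e⟩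
  rw [← e.degree_eq, hH.degree_eq]

end Isomorphism

section Counting

theorem natCard_mul_natCard_preimage_of_surjective {G H : Type*} [AddGroup G] [AddGroup H]
    (f : G →+ H) (hf : Function.Surjective f) (t : Set H) :
    Nat.card H * Nat.card (f ⁻¹' t) = Nat.card t * Nat.card G := by
  let e := QuotientAddGroup.quotientKerEquivOfSurjective f hf
  have hpre : f ⁻¹' t = QuotientAddGroup.mk (s := f.ker) ⁻¹' (e ⁻¹' t) := rfl
  have ht : Nat.card (e ⁻¹' t) = Nat.card t :=
    Nat.card_preimage_of_injective e.injective (by simp [e.surjective.range_eq])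
  rw [hpre, Nat.card_congr (QuotientAddGroup.preimageMkEquivAddSubgroupProdSet f.ker (e ⁻¹' t)),
    Nat.card_prod, ht, f.ker.card_eq_card_quotient_mul_card_addSubgroup, Nat.card_congr e.toEquiv]
  ring

section Matrix

variable {K m n : Type*} [Field K] [Fintype n] {A : Matrix m n K}

theorem surjective_mulVec_of_linearIndependent_row [Finite m] (hA : LinearIndependent K A.row) :
    Function.Surjective A.mulVec := by
  have := Fintype.ofFinite m
  have hrange : LinearMap.range A.mulVecLin = ⊤ := by
    apply Submodule.eq_top_of_finrank_eq
    rw [← Matrix.rank, hA.rank_matrix, Module.finrank_fintype_fun_eq_card]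
  exact LinearMap.range_eq_top.1 hrange

theorem natCard_mulVec_ne_zero [Fintype m] (hA : Function.Surjective A.mulVec) :
    Nat.card K ^ Fintype.card m * Nat.card {v // ∀ i, (A *ᵥ v) i ≠ 0} =
      (Nat.card K - 1) ^ Fintype.card m * Nat.card K ^ Fintype.card n := by
  have hcount := natCard_mul_natCard_preimage_of_surjective A.mulVecLin.toAddMonoidHom hA
    {y | ∀ i, y i ≠ 0}
  have hne : Nat.card {y : m → K // ∀ i, y i ≠ 0} = (Nat.card K - 1) ^ Fintype.card m := by
    rw [Nat.card_congr (Equiv.subtypePiEquivPi (p := fun _ (a : K) => a ≠ 0)), Nat.card_pi,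
      ← Nat.card_congr unitsEquivNeZero, Nat.card_units]
    simp
  rw [Nat.card_fun, Nat.card_fun, Nat.card_eq_fintype_card (α := m),
    Nat.card_eq_fintype_card (α := n)] at hcount
  rw [← hne]
  exact hcount

end Matrix

theorem natCard_points_mul_natCard_units {K V : Type*} [DivisionRing K] [AddCommGroup V]
    [Module K V] {P : V → Prop} (hzero : ¬ P 0) (hsmul : ∀ (u : Kˣ) v, P (u • v) ↔ P v) :
    Nat.card {p : ℙ K V // P p.rep} * Nat.card Kˣ = Nat.card {v // P v} := by
  rw [← Nat.card_prod]
  refine Nat.card_congr (Equiv.ofBijective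
    (fun x : {p : ℙ K V // P p.rep} × Kˣ =>
      (⟨x.2 • x.1.1.rep, (hsmul _ _).2 x.1.2⟩ : {v // P v})) ⟨?_, ?_⟩)
  · rintro ⟨⟨p, hp⟩, u⟩ ⟨⟨p', hp'⟩, u'⟩ h
    have hrep : u • p.rep = u' • p'.rep := congrArg Subtype.val h
    obtain rfl : p = p' := by
      rw [← p.mk_rep, ← p'.mk_rep, Projectivization.mk_eq_mk_iff]
      exact ⟨u⁻¹ * u', by rw [mul_smul, ← hrep, inv_smul_smul]⟩
    obtain rfl : u = u' := Units.ext (smul_left_injective K p.rep_nonzero hrep)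
    rfl
  · rintro ⟨v, hv⟩
    have hv0 : v ≠ 0 := fun h => hzero (h ▸ hv)
    obtain ⟨a, ha⟩ := Projectivization.exists_smul_eq_mk_rep K v hv0
    exact ⟨⟨⟨Projectivization.mk K v hv0, by rw [← ha]; exact (hsmul _ _).2 hv⟩, a⁻¹⟩,
      Subtype.ext (by simp [← ha])⟩

variable {F : Type*} [Field F] {m : ℕ}

theorem sympForm_units_smul_right (u : Fˣ) (v w : Fin m ⊕ Fin m → F) :
    sympForm v (u • w) = u * sympForm v w := by
  simp [sympForm, Units.smul_def, Matrix.mulVec_smul]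

variable {ι : Type*} [Fintype ι] {w : ι → Fin m ⊕ Fin m → F}

theorem natCard_sympForm_ne_zero (hw : LinearIndependent F w) :
    Nat.card F ^ Fintype.card ι * Nat.card {z // ∀ i, sympForm (w i) z ≠ 0} =
      (Nat.card F - 1) ^ Fintype.card ι * Nat.card F ^ (2 * m) := by
  have hJ : Function.Surjective (Matrix.J (Fin m) F).mulVec :=
    Matrix.mulVec_surjective_iff_isUnit.2
      ((Matrix.isUnit_iff_isUnit_det _).2 (Matrix.isUnit_det_J (Fin m) F))
  have hsurj : Function.Surjective (Matrix.of w * Matrix.J (Fin m) F).mulVec := by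
    rw [show (Matrix.of w * Matrix.J (Fin m) F).mulVec =
      (Matrix.of w).mulVec ∘ (Matrix.J (Fin m) F).mulVec by ext z; simp]
    exact (surjective_mulVec_of_linearIndependent_row hw).comp hJ
  have hcount := natCard_mulVec_ne_zero hsurj
  simp only [← Matrix.mulVec_mulVec, Fintype.card_sum, Fintype.card_fin, ← two_mul] at hcount
  exact hcount

theorem natCard_points_sympForm_ne_zero [Nonempty ι] (hw : LinearIndependent F w) :
    Nat.card F ^ Fintype.card ι * (Nat.card {p : ℙ F (Fin m ⊕ Fin m → F) //
        ∀ i, sympForm (w i) p.rep ≠ 0} * (Nat.card F - 1)) =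
      (Nat.card F - 1) ^ Fintype.card ι * Nat.card F ^ (2 * m) := by
  have hpoints := natCard_points_mul_natCard_units (K := F)
    (P := fun z => ∀ i, sympForm (w i) z ≠ 0) (by simp [sympForm])
    (by simp [sympForm_units_smul_right])
  rw [← natCard_sympForm_ne_zero hw, ← hpoints, Nat.card_units]

end Counting

section SymplecticGraph

variable (F : Type*) [Field F] [Finite F] (m : ℕ)
  [Fintype (ℙ F (Fin (m + 1) ⊕ Fin (m + 1) → F))]
  [DecidableRel (symplecticGraph F (m + 1)).Adj]

theorem symplecticGraph_isRegularOfDegree :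
    (symplecticGraph F (m + 1)).IsRegularOfDegree (Nat.card F ^ (2 * m + 1)) := by
  intro x
  have hq : 1 < Nat.card F := Finite.one_lt_card
  have hcount := natCard_points_sympForm_ne_zero (w := fun _ : Unit => x.rep)
    (LinearIndependent.of_subsingleton () x.rep_nonzero)
  have hdeg : Nat.card {p : ℙ F (Fin (m + 1) ⊕ Fin (m + 1) → F) //
      ∀ _ : Unit, sympForm x.rep p.rep ≠ 0} = (symplecticGraph F (m + 1)).degree x := by
    rw [← SimpleGraph.card_neighborSet_eq_degree, ← Nat.card_eq_fintype_card]
    exact Nat.card_congr (Equiv.subtypeEquivRight fun p => by simp [symplecticGraph])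
  rw [hdeg, Fintype.card_unit] at hcount
  have hpos : 0 < Nat.card F * (Nat.card F - 1) := Nat.mul_pos (by lia) (by lia)
  refine Nat.eq_of_mul_eq_mul_left hpos ?_
  linear_combination hcount

variable {F m} in
theorem card_commonNeighbors_symplecticGraph {x y : ℙ F (Fin (m + 1) ⊕ Fin (m + 1) → F)}
    (hxy : x ≠ y) :
    Fintype.card ((symplecticGraph F (m + 1)).commonNeighbors x y) =
      (Nat.card F - 1) * Nat.card F ^ (2 * m) := by
  have hq : 1 < Nat.card F := Finite.one_lt_card
  have hcount := natCard_points_sympForm_ne_zero (Projectivization.independent_iff.1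
    ((Projectivization.independent_pair_iff_ne x y).2 hxy))
  have hnbr : Nat.card {p : ℙ F (Fin (m + 1) ⊕ Fin (m + 1) → F) //
      ∀ i, sympForm ((Projectivization.rep ∘ ![x, y]) i) p.rep ≠ 0} =
      Fintype.card ((symplecticGraph F (m + 1)).commonNeighbors x y) := by
    rw [← Nat.card_eq_fintype_card]
    exact Nat.card_congr (Equiv.subtypeEquivRight fun p => by
      simp [Fin.forall_fin_two, SimpleGraph.mem_commonNeighbors, symplecticGraph])
  rw [hnbr, Fintype.card_fin] at hcount
  have hpos : 0 < Nat.card F ^ 2 * (Nat.card F - 1) := Nat.mul_pos (by positivity) (by lia)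
  refine Nat.eq_of_mul_eq_mul_left hpos ?_
  linear_combination hcount

theorem symplecticGraph_isSRGWith :
    (symplecticGraph F (m + 1)).IsSRGWith
      (Fintype.card (ℙ F (Fin (m + 1) ⊕ Fin (m + 1) → F)))
      (Nat.card F ^ (2 * m + 1)) ((Nat.card F - 1) * Nat.card F ^ (2 * m))
      ((Nat.card F - 1) * Nat.card F ^ (2 * m)) where
  card := rfl
  regular := symplecticGraph_isRegularOfDegree F m
  of_adj _ _ hxy := card_commonNeighbors_symplecticGraph hxy.ne
  of_not_adj _ _ hxy _ := card_commonNeighbors_symplecticGraph hxy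

variable [DecidableEq (ℙ F (Fin (m + 1) ⊕ Fin (m + 1) → F))]

theorem symplecticGraph_hasRestrictedEigenvalues :
    HasRestrictedEigenvalues (symplecticGraph F (m + 1)) ((Nat.card F : ℝ) ^ m)
      (-(Nat.card F : ℝ) ^ m) := by
  apply HasRestrictedEigenvalues.of_isSRGWith (symplecticGraph_isSRGWith F m)
  · ring
  · rw [Nat.cast_mul, Nat.cast_pred Nat.card_pos]
    push_cast
    ring

end SymplecticGraph

section Parameters

variable (F : Type*) [Field F] [Finite F] (m : ℕ) [Fintype (ℙ F (Fin (m + 1) ⊕ Fin (m + 1) → F))]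

theorem natCard_mul_pow_eq_sub_one_mul_card_points_add_one :
    (Nat.card F : ℝ) * (Nat.card F ^ (2 * m + 1) : ℕ) =
      (Nat.card F - 1) * Fintype.card (ℙ F (Fin (m + 1) ⊕ Fin (m + 1) → F)) + 1 := by
  have hcard := Projectivization.card' F (Fin (m + 1) ⊕ Fin (m + 1) → F)
  rw [Nat.card_fun, Nat.card_eq_fintype_card (α := Fin (m + 1) ⊕ Fin (m + 1)), Fintype.card_sum,
    Fintype.card_fin, Nat.card_eq_fintype_card (α := ℙ F _)] at hcard
  rw [← Nat.cast_pred Nat.card_pos]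
  norm_cast
  linear_combination hcard

theorem pow_lt_card_points :
    Nat.card F ^ (2 * m + 1) < Fintype.card (ℙ F (Fin (m + 1) ⊕ Fin (m + 1) → F)) := by
  classical
  obtain ⟨x⟩ : Nonempty (ℙ F (Fin (m + 1) ⊕ Fin (m + 1) → F)) := inferInstance
  rw [← symplecticGraph_isRegularOfDegree F m x]
  exact (symplecticGraph F (m + 1)).degree_lt_card_verts x

theorem lt_card_points : m < Fintype.card (ℙ F (Fin (m + 1) ⊕ Fin (m + 1) → F)) :=
  calc m < 2 * m + 1 := by lia
    _ < Nat.card F ^ (2 * m + 1) := Nat.lt_pow_self Finite.one_lt_card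
    _ < _ := pow_lt_card_points F m

theorem cast_card_sub_one_sub_pow :
    ((Fintype.card (ℙ F (Fin (m + 1) ⊕ Fin (m + 1) → F)) - 1 - Nat.card F ^ (2 * m + 1) : ℕ) : ℝ) =
      Fintype.card (ℙ F (Fin (m + 1) ⊕ Fin (m + 1) → F)) - 1 - (Nat.card F ^ (2 * m + 1) : ℕ) := by
  have hlt := pow_lt_card_points F m
  rw [Nat.cast_sub (by lia), Nat.cast_sub (by lia), Nat.cast_one]

variable [DecidableEq (ℙ F (Fin (m + 1) ⊕ Fin (m + 1) → F))]
  [DecidableRel (symplecticGraph F (m + 1)).Adj]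

theorem graphEnergy_symplecticGraph {n k : ℕ}
    (hn : n = Fintype.card (ℙ F (Fin (m + 1) ⊕ Fin (m + 1) → F)))
    (hk : k = Nat.card F ^ (2 * m + 1)) :
    graphEnergy (symplecticGraph F (m + 1)) = k + √((k : ℝ) * (n - k) * (n - 1)) := by
  subst hn hk
  exact (symplecticGraph_hasRestrictedEigenvalues F m).graphEnergy_eq_add_sqrt
    (symplecticGraph_isRegularOfDegree F m) (pow_pos (Nat.cast_pos.2 Nat.card_pos) m)

theorem graphEnergy_compl_symplecticGraph_gt {n k : ℕ}
    (hn : n = Fintype.card (ℙ F (Fin (m + 1) ⊕ Fin (m + 1) → F)))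
    (hk : k = n - 1 - Nat.card F ^ (2 * m + 1)) :
    graphEnergy (symplecticGraph F (m + 1))ᶜ > √((k : ℝ) * (n - k) * n) - n + k + 1 := by
  subst hn hk
  have hq : (2 : ℝ) ≤ Nat.card F := by exact_mod_cast Finite.one_lt_card (α := F)
  have hdegree : 2 * ((Nat.card F : ℝ) ^ m) ^ 2 ≤ ((Nat.card F ^ (2 * m + 1) : ℕ) : ℝ) := by
    calc 2 * ((Nat.card F : ℝ) ^ m) ^ 2 ≤ Nat.card F * ((Nat.card F : ℝ) ^ m) ^ 2 := by gcongr
      _ = ((Nat.card F ^ (2 * m + 1) : ℕ) : ℝ) := by push_cast; ring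
  have hlt := (symplecticGraph_hasRestrictedEigenvalues F m).sqrt_sub_lt_graphEnergy_compl
    (symplecticGraph_isRegularOfDegree F m) (one_le_pow₀ (by linarith)) hdegree
  rw [cast_card_sub_one_sub_pow]
  convert hlt using 1
  ring_nf

end Parameters

theorem exists_field_natCard_eq {q : ℕ} (hq : IsPrimePow q) :
    ∃ (F : Type) (_ : Field F), Nat.card F = q := by
  obtain ⟨p, r, hp, hr, rfl⟩ := (isPrimePow_nat_iff q).1 hq
  have : Fact p.Prime := ⟨hp⟩
  exact ⟨GaloisField p r, inferInstance, GaloisField.card p r hr.ne'⟩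

theorem mainTheorem8 (q : ℕ) (hq : IsPrimePow q) :
    (∀ n₀ : ℕ, ∃ (n k : ℕ) (G : SimpleGraph (Fin n)) (_ : DecidableRel G.Adj),
      n₀ < n ∧
      (∃ (m : ℕ) (F : Type) (_ : Field F),
        1 ≤ m ∧ Nat.card F = q ∧ Nonempty (G ≃g symplecticGraph F m)) ∧
      G.IsRegularOfDegree k ∧
      (k : ℝ) = ((q : ℝ) - 1) / q * n + 1 / q ∧
      graphEnergy G = k + √((k : ℝ) * ((n : ℝ) - k) * ((n : ℝ) - 1))) ∧
    (∀ n₀ : ℕ, ∃ (n k : ℕ) (G : SimpleGraph (Fin n)) (_ : DecidableRel G.Adj),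
      n₀ < n ∧
      (∃ (m : ℕ) (F : Type) (_ : Field F),
        1 ≤ m ∧ Nat.card F = q ∧ Nonempty (G ≃g (symplecticGraph F m)ᶜ)) ∧
      G.IsRegularOfDegree k ∧
      (k : ℝ) = (n : ℝ) / q - ((q : ℝ) + 1) / q ∧
      graphEnergy G > √((k : ℝ) * ((n : ℝ) - k) * n) - n + k + 1) := by
  obtain ⟨F, _, rfl⟩ := exists_field_natCard_eq hq
  have : Finite F := Nat.finite_of_card_ne_zero hq.ne_zero
  have hq0 : (Nat.card F : ℝ) ≠ 0 := Nat.cast_ne_zero.2 hq.ne_zero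
  classical
  refine ⟨fun n₀ => ?_, fun n₀ => ?_⟩
  all_goals
    have := Fintype.ofFinite (ℙ F (Fin (n₀ + 1) ⊕ Fin (n₀ + 1) → F))
    have hreg := symplecticGraph_isRegularOfDegree F n₀
    have hcard := natCard_mul_pow_eq_sub_one_mul_card_points_add_one F n₀
  · obtain ⟨G, _, hiso, hG, henergy⟩ := exists_iso_fin_of_isRegularOfDegree hreg
    refine ⟨_, _, G, inferInstance, lt_card_points F n₀,
      ⟨n₀ + 1, F, inferInstance, by lia, rfl, hiso⟩, hG, ?_,
      henergy.trans (graphEnergy_symplecticGraph F n₀ rfl rfl)⟩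
    field_simp
    linear_combination hcard
  · obtain ⟨G, _, hiso, hG, henergy⟩ := exists_iso_fin_of_isRegularOfDegree hreg.compl
    refine ⟨_, _, G, inferInstance, lt_card_points F n₀,
      ⟨n₀ + 1, F, inferInstance, by lia, rfl, hiso⟩, hG, ?_,
      (graphEnergy_compl_symplecticGraph_gt F n₀ rfl rfl).trans_eq henergy.symm⟩
    rw [cast_card_sub_one_sub_pow]
    field_simp
    linear_combination -hcard
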